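/- Let $H$ be a complex Hilbert space of dimension at least $2$ and let $T$ be a bounded linear operator on $H$. Let $m(T)=\inf\{\|Tx\| : \|x\|=1\}$ be the minimum modulus of $T$, and let $\hat\varepsilon(T)$ be the infimum of all $\varepsilon\in[0,1]$ such that, for all $x,y\in H$, $\langle x,y\rangle=0$ implies $|\langle Tx,Ty\rangle|\le\varepsilon\,\|Tx\|\,\|Ty\|$. Let $\mathbb{C}\mathcal{V}$ be the set of all scalar multiples $\lambda V$, where $\lambda\in\mathbb{C}$ and $V$ is a (not necessarily surjective) linear isometry of $H$ into itself, and let $\mathrm{dist}(T,\mathbb{C}\mathcal{V})=\inf\{\|T-S\| : S\in\mathbb{C}\mathcal{V}\}$ in the operator norm. If $\dim\ker T\le\dim\ker T^{*}$, where $\dim$ denotes the Hilbert space dimension (the cardinality of an orthonormal basis), then $$\mathrm{dist}(T,\mathbb{C}\mathcal{V})=\frac{\|T\|-m(T)}{2}=\frac{1-\sqrt{\frac{1-\hat\varepsilon(T)}{1+\hat\varepsilon(T)}}}{2}\,\|T\|.$$ -/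

import Mathlib

noncomputable section

/-- Hilbert-space dimension: the cardinality of a Hilbert (complete orthonormal) basis. All Hilbert
bases of a Hilbert space are equipotent, so the infimum below is their common cardinality. This is
not the algebraic dimension `Module.rank`, which is different in infinite dimension. -/
def hilbertDim.{u} (E : Type u) [NormedAddCommGroup E] [InnerProductSpace ℂ E] : Cardinal.{u} :=
  sInf {c : Cardinal.{u} | ∃ ι : Type u, Nonempty (HilbertBasis ι ℂ E) ∧ Cardinal.mk ι = c}

section Operators

variable {H : Type*} [NormedAddCommGroup H] [InnerProductSpace ℂ H]

/-- The minimum modulus `m(T) = inf {‖T x‖ : ‖x‖ = 1}`. -/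
def minModulus (T : H →L[ℂ] H) : ℝ :=
  sInf {r : ℝ | ∃ x : H, ‖x‖ = 1 ∧ ‖T x‖ = r}

/-- Two vectors are `ε`-orthogonal if `|⟨x, y⟩| ≤ ε ‖x‖ ‖y‖`. -/
def EpsOrthogonal (ε : ℝ) (x y : H) : Prop :=
  ‖inner ℂ x y‖ ≤ ε * ‖x‖ * ‖y‖

/-- `T` is `ε`-approximately orthogonality preserving. (For `ε = 1` this holds for every `T`, by
the Cauchy-Schwarz inequality.) -/
def IsAOP (ε : ℝ) (T : H →L[ℂ] H) : Prop :=
  ∀ x y : H, inner ℂ x y = 0 → EpsOrthogonal ε (T x) (T y)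

/-- The infimum of all `ε ∈ [0, 1]` for which `T` is `ε`-approximately orthogonality preserving. -/
def epsHat (T : H →L[ℂ] H) : ℝ :=
  sInf {ε : ℝ | ε ∈ Set.Icc (0 : ℝ) 1 ∧ IsAOP ε T}

/-- The set of all scalar multiples of (not necessarily surjective) linear isometries of `H`. -/
def scalarIsometries (H : Type*) [NormedAddCommGroup H] [InnerProductSpace ℂ H] :
    Set (H →L[ℂ] H) :=
  {S | ∃ (c : ℂ) (V : H →L[ℂ] H), Isometry V ∧ S = c • V}

end Operators

end

/-!
Write `T = V |T|`. On the closure of the range of `|T|` the isometry `V` is forced; since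
`(range |T|)ᗮ = ker T` embeds isometrically into `ker T* = (range T)ᗮ`, it extends to an isometry of
the whole space. The spectrum of `|T|` lies in `[m(T), ‖T‖]`, so the multiple of `V` by the midpoint
of this interval is within `(‖T‖ - m(T)) / 2` of `T`. No scalar isometry is closer, because the norm
and the minimum modulus are both 1-Lipschitz and agree on scalar isometries.

For the second equality, `T` is `ε`-AOP if and only if `(1 - ε) ‖T‖² ≤ (1 + ε) m(T)²`. One direction
is Wielandt's inequality. For the other, given unit vectors `x` and `y`, rotate `y` by a phase to
make `⟪x, y⟫` real and test `T` on the orthogonal pair `x + y`, `x - y`.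
-/

section InnerProductSpace

variable {𝕜 E F : Type*} [RCLike 𝕜] [NormedAddCommGroup E] [InnerProductSpace 𝕜 E]
  [NormedAddCommGroup F] [InnerProductSpace 𝕜 F]

theorem re_inner_add_sub (x y : E) :
    RCLike.re (inner 𝕜 (x + y) (x - y)) = ‖x‖ ^ 2 - ‖y‖ ^ 2 := by
  simp only [inner_add_left, inner_sub_right, map_add, map_sub, inner_self_eq_norm_sq,
    inner_re_symm (𝕜 := 𝕜) x y]
  ring

theorem inner_add_sub_eq_zero {x y : E} (him : RCLike.im (inner 𝕜 x y) = 0)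
    (hnorm : ‖x‖ = ‖y‖) : inner 𝕜 (x + y) (x - y) = 0 := by
  refine RCLike.ext ?_ ?_
  · simp [re_inner_add_sub, hnorm]
  · simp [inner_add_left, inner_sub_right, inner_im_symm (𝕜 := 𝕜) y x, him]

include 𝕜 in
theorem norm_add_mul_norm_sub_le (x y : E) : ‖x + y‖ * ‖x - y‖ ≤ ‖x‖ ^ 2 + ‖y‖ ^ 2 := by
  have hpar := parallelogram_law_with_norm 𝕜 x y
  linarith [two_mul_le_add_sq ‖x + y‖ ‖x - y‖]

theorem mul_re_inner_map_le {m M : ℝ} (hm : 0 ≤ m) (hM : 0 ≤ M) {f : E →ₗ[𝕜] F}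
    (hlow : ∀ z, m * ‖z‖ ≤ ‖f z‖) (hup : ∀ z, ‖f z‖ ≤ M * ‖z‖) {x y : E} (hxy : inner 𝕜 x y = 0) :
    (M ^ 2 + m ^ 2) * (2 * RCLike.re (inner 𝕜 (f x) (f y))) ≤
      (M ^ 2 - m ^ 2) * (‖f x‖ ^ 2 + ‖f y‖ ^ 2) := by
  have hnorm : ‖x + y‖ = ‖x - y‖ := by
    rw [norm_sub_rev, norm_sub_eq_norm_add hxy, add_comm]
  have hratio : m * ‖f x + f y‖ ≤ M * ‖f x - f y‖ :=
    calc m * ‖f x + f y‖ ≤ m * (M * ‖x - y‖) := by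
          rw [← map_add, ← hnorm]; gcongr; exact hup _
      _ = M * (m * ‖x - y‖) := mul_left_comm ..
      _ ≤ M * ‖f x - f y‖ := by rw [← map_sub]; gcongr; exact hlow _
  have hsq := pow_le_pow_left₀ (by positivity) hratio 2
  rw [mul_pow, mul_pow, norm_add_sq (𝕜 := 𝕜), norm_sub_sq (𝕜 := 𝕜)] at hsq
  linarith

/-- Wielandt's inequality. -/
theorem mul_norm_inner_map_le {m M : ℝ} (hm : 0 ≤ m) (hM : 0 ≤ M) {f : E →ₗ[𝕜] F}
    (hlow : ∀ z, m * ‖z‖ ≤ ‖f z‖) (hup : ∀ z, ‖f z‖ ≤ M * ‖z‖) {x y : E} (hxy : inner 𝕜 x y = 0) :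
    (M ^ 2 + m ^ 2) * ‖inner 𝕜 (f x) (f y)‖ ≤ (M ^ 2 - m ^ 2) * (‖f x‖ * ‖f y‖) := by
  rcases eq_or_ne (f x) 0 with hx | hx
  · simp [hx]
  rcases eq_or_ne (f y) 0 with hy | hy
  · simp [hy]
  obtain ⟨θ, hθ, hθxy⟩ := RCLike.exists_norm_eq_mul_self (inner 𝕜 (f x) (f y))
  -- Rescaling equalises the two norms and makes the inner product of the images a nonnegative real.
  have key := mul_re_inner_map_le hm hM hlow hup
    (x := (‖f y‖ : 𝕜) • x) (y := ((‖f x‖ : 𝕜) * θ) • y)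
    (by simp [inner_smul_left, inner_smul_right, hxy])
  have hre : RCLike.re (inner 𝕜 (f ((‖f y‖ : 𝕜) • x)) (f (((‖f x‖ : 𝕜) * θ) • y))) =
      ‖f x‖ * ‖f y‖ * ‖inner 𝕜 (f x) (f y)‖ := by
    have : inner 𝕜 (f ((‖f y‖ : 𝕜) • x)) (f (((‖f x‖ : 𝕜) * θ) • y)) =
        ((‖f x‖ * ‖f y‖ * ‖inner 𝕜 (f x) (f y)‖ : ℝ) : 𝕜) := by
      simp only [map_smul, inner_smul_left, inner_smul_right, RCLike.conj_ofReal]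
      push_cast
      linear_combination (-(‖f x‖ * ‖f y‖ : 𝕜)) * hθxy
    rw [this, RCLike.ofReal_re]
  rw [hre, map_smul, map_smul, norm_smul, norm_smul, norm_mul, hθ] at key
  simp only [RCLike.norm_ofReal, abs_norm, mul_one] at key
  refine le_of_mul_le_mul_left ?_ (mul_pos (norm_pos_iff.2 hx) (norm_pos_iff.2 hy))
  linarith

theorem one_sub_mul_norm_map_sq_le {ε : ℝ} (hε : 0 ≤ ε) {f : E →ₗ[𝕜] F}
    (hf : ∀ x y, inner 𝕜 x y = 0 → ‖inner 𝕜 (f x) (f y)‖ ≤ ε * ‖f x‖ * ‖f y‖) {x y : E}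
    (hxy : ‖x‖ = ‖y‖) : (1 - ε) * ‖f x‖ ^ 2 ≤ (1 + ε) * ‖f y‖ ^ 2 := by
  obtain ⟨θ, hθ, hθxy⟩ := RCLike.exists_norm_eq_mul_self (inner 𝕜 x y)
  have horth : inner 𝕜 (x + θ • y) (x - θ • y) = 0 :=
    inner_add_sub_eq_zero (by rw [inner_smul_right, ← hθxy, RCLike.ofReal_im])
      (by rw [norm_smul, hθ, one_mul, hxy])
  have hfy : ‖f (θ • y)‖ = ‖f y‖ := by rw [map_smul, norm_smul, hθ, one_mul]
  have key : ‖f x‖ ^ 2 - ‖f y‖ ^ 2 ≤ ε * (‖f x‖ ^ 2 + ‖f y‖ ^ 2) :=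
    calc ‖f x‖ ^ 2 - ‖f y‖ ^ 2
        = RCLike.re (inner 𝕜 (f (x + θ • y)) (f (x - θ • y))) := by
          rw [map_add, map_sub, re_inner_add_sub, hfy]
      _ ≤ ‖inner 𝕜 (f (x + θ • y)) (f (x - θ • y))‖ := RCLike.re_le_norm _
      _ ≤ ε * (‖f x + f (θ • y)‖ * ‖f x - f (θ • y)‖) := by
          rw [← map_add, ← map_sub, ← mul_assoc]; exact hf _ _ horth
      _ ≤ ε * (‖f x‖ ^ 2 + ‖f y‖ ^ 2) := by
          rw [← hfy]; gcongr; exact norm_add_mul_norm_sub_le (𝕜 := 𝕜) _ _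
  linarith

theorem exists_linearIsometry_extend {K : Submodule 𝕜 E} [K.HasOrthogonalProjection]
    {L : Submodule 𝕜 F} (U : K →ₗᵢ[𝕜] L) (W : Kᗮ →ₗᵢ[𝕜] Lᗮ) :
    ∃ V : E →ₗᵢ[𝕜] F, ∀ k : K, V k = U k := by
  let V : E →L[𝕜] F :=
    L.subtypeL ∘L U.toContinuousLinearMap ∘L K.orthogonalProjectionOnto +
      Lᗮ.subtypeL ∘L W.toContinuousLinearMap ∘L Kᗮ.orthogonalProjectionOnto
  have hV (x : E) : V x = U (K.orthogonalProjectionOnto x) + W (Kᗮ.orthogonalProjectionOnto x) :=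
    rfl
  refine ⟨⟨V, fun x => ?_⟩, fun k => ?_⟩
  · have horth : inner 𝕜 (U (K.orthogonalProjectionOnto x) : F)
        (W (Kᗮ.orthogonalProjectionOnto x) : F) = 0 :=
      L.inner_right_of_mem_orthogonal (SetLike.coe_mem _) (SetLike.coe_mem _)
    rw [← sq_eq_sq₀ (norm_nonneg _) (norm_nonneg _), K.norm_sq_eq_add_norm_sq_projection x,
      ContinuousLinearMap.coe_coe, hV, norm_add_sq (𝕜 := 𝕜), horth, Submodule.norm_coe,
      Submodule.norm_coe, U.norm_map, W.norm_map, map_zero, mul_zero, add_zero]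
  · change V k = U k
    rw [hV, K.orthogonalProjectionOnto_mem_subspace_eq_self,
      Submodule.orthogonalProjectionOnto_eq_zero_iff.2 (K.le_orthogonal_orthogonal k.2), map_zero,
      Submodule.coe_zero, add_zero]

theorem denseRange_codRestrict_topologicalClosure {G : Type*} [AddCommGroup G] [Module 𝕜 G]
    (S : G →ₗ[𝕜] E) :
    DenseRange (S.codRestrict S.range.topologicalClosure
      fun x => S.range.le_topologicalClosure ⟨x, rfl⟩) := by
  rw [DenseRange, Subtype.dense_iff]
  intro x hx
  rw [← Set.range_comp]
  exact hx

theorem exists_linearIsometryEquiv_topologicalClosure_range [CompleteSpace E] [CompleteSpace F]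
    {G : Type*} [AddCommGroup G] [Module 𝕜 G] {S : G →ₗ[𝕜] E} {T : G →ₗ[𝕜] F}
    (hnorm : ∀ x, ‖T x‖ = ‖S x‖) :
    ∃ U : S.range.topologicalClosure ≃ₗᵢ[𝕜] T.range.topologicalClosure,
      ∀ x, (U ⟨S x, S.range.le_topologicalClosure ⟨x, rfl⟩⟩ : F) = T x :=
  ⟨(LinearEquiv.refl 𝕜 G).extendOfIsometry _ _ (denseRange_codRestrict_topologicalClosure S)
      (denseRange_codRestrict_topologicalClosure T) hnorm,
    fun x => congrArg Subtype.val (LinearEquiv.extendOfIsometry_eq _ _ _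
      (denseRange_codRestrict_topologicalClosure S)
      (denseRange_codRestrict_topologicalClosure T) hnorm x)⟩

theorem exists_linearIsometry_comp_eq [CompleteSpace E] [CompleteSpace F] {G : Type*}
    [AddCommGroup G] [Module 𝕜 G] {S : G →ₗ[𝕜] E} {T : G →ₗ[𝕜] F} (hnorm : ∀ x, ‖T x‖ = ‖S x‖)
    (W : S.rangeᗮ →ₗᵢ[𝕜] T.rangeᗮ) : ∃ V : E →ₗᵢ[𝕜] F, ∀ x, V (S x) = T x := by
  rw [← S.range.orthogonal_closure, ← T.range.orthogonal_closure] at W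
  obtain ⟨U, hU⟩ := exists_linearIsometryEquiv_topologicalClosure_range hnorm
  obtain ⟨V, hV⟩ := exists_linearIsometry_extend U.toLinearIsometry W
  exact ⟨V, fun x => (hV ⟨S x, S.range.le_topologicalClosure ⟨x, rfl⟩⟩).trans (hU x)⟩

end InnerProductSpace

theorem exists_hilbertBasis_mk_eq_hilbertDim.{u} (E : Type u) [NormedAddCommGroup E]
    [InnerProductSpace ℂ E] [CompleteSpace E] :
    ∃ ι : Type u, Nonempty (HilbertBasis ι ℂ E) ∧ Cardinal.mk ι = hilbertDim E := by
  obtain ⟨w, b, -⟩ := exists_hilbertBasis ℂ E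
  exact csInf_mem
    (s := {c | ∃ ι : Type u, Nonempty (HilbertBasis ι ℂ E) ∧ Cardinal.mk ι = c}) ⟨_, w, ⟨b⟩, rfl⟩

theorem nonempty_linearIsometry_of_hilbertDim_le.{u} {E F : Type u} [NormedAddCommGroup E]
    [InnerProductSpace ℂ E] [CompleteSpace E] [NormedAddCommGroup F] [InnerProductSpace ℂ F]
    [CompleteSpace F] (h : hilbertDim E ≤ hilbertDim F) : Nonempty (E →ₗᵢ[ℂ] F) := by
  obtain ⟨ι, ⟨b⟩, hι⟩ := exists_hilbertBasis_mk_eq_hilbertDim E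
  obtain ⟨κ, ⟨c⟩, hκ⟩ := exists_hilbertBasis_mk_eq_hilbertDim F
  rw [← hι, ← hκ] at h
  obtain ⟨f⟩ := h
  have hc : Orthonormal ℂ (c ∘ f) := c.orthonormal.comp f f.injective
  exact ⟨hc.orthogonalFamily.linearIsometry.comp b.repr.toLinearIsometry⟩

section MinModulus

variable {H : Type*} [NormedAddCommGroup H] [InnerProductSpace ℂ H] {S T : H →L[ℂ] H}

theorem minModulus_nonneg (T : H →L[ℂ] H) : 0 ≤ minModulus T :=
  Real.sInf_nonneg (by rintro _ ⟨x, -, rfl⟩; exact norm_nonneg _)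

theorem minModulus_le_norm_apply (T : H →L[ℂ] H) {x : H} (hx : ‖x‖ = 1) :
    minModulus T ≤ ‖T x‖ :=
  csInf_le ⟨0, by rintro _ ⟨x, -, rfl⟩; exact norm_nonneg _⟩ ⟨x, hx, rfl⟩

theorem minModulus_mul_norm_le (T : H →L[ℂ] H) (x : H) : minModulus T * ‖x‖ ≤ ‖T x‖ := by
  rcases eq_or_ne x 0 with rfl | hx
  · simp
  have h := minModulus_le_norm_apply T (norm_smul_inv_norm (𝕜 := ℂ) hx)
  rw [map_smul, norm_smul, norm_inv, RCLike.norm_ofReal, abs_norm, ← div_eq_inv_mul] at h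
  exact (le_div_iff₀ (norm_pos_iff.2 hx)).1 h

variable [Nontrivial H]

theorem le_minModulus {r : ℝ} (h : ∀ x : H, ‖x‖ = 1 → r ≤ ‖T x‖) : r ≤ minModulus T := by
  obtain ⟨x, hx⟩ := exists_norm_eq H zero_le_one
  exact le_csInf ⟨_, x, hx, rfl⟩ (by rintro _ ⟨y, hy, rfl⟩; exact h y hy)

theorem le_minModulus_sq {r : ℝ} (h : ∀ x : H, ‖x‖ = 1 → r ≤ ‖T x‖ ^ 2) : r ≤ minModulus T ^ 2 :=
  (Real.sqrt_le_iff.1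
    (le_minModulus fun x hx => Real.sqrt_le_iff.2 ⟨norm_nonneg _, h x hx⟩)).2

theorem minModulus_le_norm (T : H →L[ℂ] H) : minModulus T ≤ ‖T‖ := by
  obtain ⟨x, hx⟩ := exists_norm_eq H zero_le_one
  exact (minModulus_le_norm_apply T hx).trans (T.unit_le_opNorm x hx.le)

theorem norm_sq_le_of_unit_norm {r : ℝ} (h : ∀ x : H, ‖x‖ = 1 → ‖T x‖ ^ 2 ≤ r) : ‖T‖ ^ 2 ≤ r := by
  obtain ⟨x, hx⟩ := exists_norm_eq H zero_le_one
  have hr : 0 ≤ r := (sq_nonneg _).trans (h x hx)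
  exact (Real.le_sqrt (norm_nonneg T) hr).1 (ContinuousLinearMap.opNorm_le_of_unit_norm
    (Real.sqrt_nonneg r) fun y hy => Real.le_sqrt_of_sq_le (h y hy))

theorem minModulus_sub_le_norm_sub (S T : H →L[ℂ] H) : minModulus S - minModulus T ≤ ‖S - T‖ := by
  refine sub_le_comm.1 (le_minModulus fun x hx => sub_le_comm.1 ?_)
  calc minModulus S - ‖T x‖ ≤ ‖S x‖ - ‖T x‖ := by gcongr; exact minModulus_le_norm_apply S hx
    _ ≤ ‖(S - T) x‖ := norm_sub_norm_le _ _
    _ ≤ ‖S - T‖ := (S - T).unit_le_opNorm x hx.le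

theorem norm_eq_minModulus_of_mem_scalarIsometries (hS : S ∈ scalarIsometries H) :
    ‖S‖ = minModulus S := by
  obtain ⟨c, V, hV, rfl⟩ := hS
  have hnorm (x : H) : ‖(c • V) x‖ = ‖c‖ * ‖x‖ := by
    rw [smul_apply, norm_smul, hV.norm_map_of_map_zero (map_zero V)]
  refine le_antisymm ?_ (minModulus_le_norm _)
  calc ‖c • V‖ ≤ ‖c‖ := (c • V).opNorm_le_bound (norm_nonneg c) fun x => (hnorm x).le
    _ ≤ minModulus (c • V) := le_minModulus fun x hx => by rw [hnorm, hx, mul_one]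

theorem half_norm_sub_minModulus_le_norm_sub (T : H →L[ℂ] H) (hS : S ∈ scalarIsometries H) :
    (‖T‖ - minModulus T) / 2 ≤ ‖T - S‖ := by
  linarith [norm_sub_norm_le T S, norm_sub_rev S T, minModulus_sub_le_norm_sub S T,
    norm_eq_minModulus_of_mem_scalarIsometries hS]

end MinModulus

section ApproximateOrthogonality

variable {H : Type*} [NormedAddCommGroup H] [InnerProductSpace ℂ H] [Nontrivial H]
  {T : H →L[ℂ] H} {ε : ℝ}

theorem IsAOP.mul_norm_sq_le (hT : IsAOP ε T) (hε : ε ∈ Set.Icc 0 1) :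
    (1 - ε) * ‖T‖ ^ 2 ≤ (1 + ε) * minModulus T ^ 2 := by
  have hpos : 0 < 1 + ε := by linarith [hε.1]
  have hpointwise (x : H) (hx : ‖x‖ = 1) : (1 - ε) * ‖T x‖ ^ 2 ≤ (1 + ε) * minModulus T ^ 2 := by
    rw [← div_le_iff₀' hpos]
    refine le_minModulus_sq fun y hy => ?_
    rw [div_le_iff₀' hpos]
    exact one_sub_mul_norm_map_sq_le hε.1 hT (hx.trans hy.symm)
  rcases hε.2.eq_or_lt with rfl | hlt
  · rw [sub_self, zero_mul]
    positivity
  · rw [← le_div_iff₀' (sub_pos.2 hlt)]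
    exact norm_sq_le_of_unit_norm fun x hx =>
      (le_div_iff₀' (sub_pos.2 hlt)).2 (hpointwise x hx)

theorem isAOP_iff (hε : ε ∈ Set.Icc 0 1) :
    IsAOP ε T ↔ (1 - ε) * ‖T‖ ^ 2 ≤ (1 + ε) * minModulus T ^ 2 := by
  refine ⟨fun hT => hT.mul_norm_sq_le hε, fun h x y hxy => ?_⟩
  rcases eq_or_ne T 0 with rfl | hT
  · simp [EpsOrthogonal]
  have hpos : 0 < ‖T‖ ^ 2 + minModulus T ^ 2 := by positivity
  refine le_of_mul_le_mul_left ?_ hpos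
  calc (‖T‖ ^ 2 + minModulus T ^ 2) * ‖inner ℂ (T x) (T y)‖
      ≤ (‖T‖ ^ 2 - minModulus T ^ 2) * (‖T x‖ * ‖T y‖) :=
        mul_norm_inner_map_le (minModulus_nonneg T) (norm_nonneg T) (minModulus_mul_norm_le T)
          T.le_opNorm hxy
    _ ≤ (ε * (‖T‖ ^ 2 + minModulus T ^ 2)) * (‖T x‖ * ‖T y‖) := by gcongr; linarith
    _ = (‖T‖ ^ 2 + minModulus T ^ 2) * (ε * ‖T x‖ * ‖T y‖) := by ring

theorem epsHat_eq (hT : T ≠ 0) :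
    epsHat T = (‖T‖ ^ 2 - minModulus T ^ 2) / (‖T‖ ^ 2 + minModulus T ^ 2) := by
  have hpos : 0 < ‖T‖ ^ 2 + minModulus T ^ 2 := by positivity
  set ε₀ := (‖T‖ ^ 2 - minModulus T ^ 2) / (‖T‖ ^ 2 + minModulus T ^ 2) with hε₀
  have hε₀_nonneg : 0 ≤ ε₀ :=
    div_nonneg (sub_nonneg.2 (pow_le_pow_left₀ (minModulus_nonneg T) (minModulus_le_norm T) 2))
      hpos.le
  have hε₀_le_one : ε₀ ≤ 1 := (div_le_one hpos).2 (by linarith [sq_nonneg (minModulus T)])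
  have hε₀_le_iff (ε : ℝ) : ε₀ ≤ ε ↔ (1 - ε) * ‖T‖ ^ 2 ≤ (1 + ε) * minModulus T ^ 2 := by
    rw [hε₀, div_le_iff₀ hpos]
    constructor <;> intro h <;> linarith
  have hset : {ε : ℝ | ε ∈ Set.Icc (0 : ℝ) 1 ∧ IsAOP ε T} = Set.Icc ε₀ 1 := by
    ext ε
    constructor
    · rintro ⟨hε, hAOP⟩
      exact ⟨(hε₀_le_iff ε).2 ((isAOP_iff hε).1 hAOP), hε.2⟩
    · rintro ⟨hε, hε1⟩
      have hmem : ε ∈ Set.Icc (0 : ℝ) 1 := ⟨hε₀_nonneg.trans hε, hε1⟩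
      exact ⟨hmem, (isAOP_iff hmem).2 ((hε₀_le_iff ε).1 hε)⟩
  rw [epsHat, hset, csInf_Icc hε₀_le_one]

theorem sqrt_one_sub_epsHat_div_eq (hT : T ≠ 0) :
    √((1 - epsHat T) / (1 + epsHat T)) = minModulus T / ‖T‖ := by
  have hpos : 0 < ‖T‖ ^ 2 + minModulus T ^ 2 := by positivity
  have hsub : 1 - epsHat T = 2 * minModulus T ^ 2 / (‖T‖ ^ 2 + minModulus T ^ 2) := by
    rw [epsHat_eq hT]; field_simp; ring
  have hadd : 1 + epsHat T = 2 * ‖T‖ ^ 2 / (‖T‖ ^ 2 + minModulus T ^ 2) := by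
    rw [epsHat_eq hT]; field_simp; ring
  rw [hsub, hadd, div_div_div_cancel_right₀ hpos.ne', mul_div_mul_left _ _ two_ne_zero, ← div_pow,
    Real.sqrt_sq (div_nonneg (minModulus_nonneg T) (norm_nonneg T))]

theorem half_norm_sub_minModulus_eq (T : H →L[ℂ] H) :
    (‖T‖ - minModulus T) / 2 = (1 - √((1 - epsHat T) / (1 + epsHat T))) / 2 * ‖T‖ := by
  rcases eq_or_ne T 0 with rfl | hT
  · have hm : minModulus (0 : H →L[ℂ] H) = 0 :=
      le_antisymm ((minModulus_le_norm _).trans_eq norm_zero) (minModulus_nonneg _)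
    simp [hm]
  · rw [sqrt_one_sub_epsHat_div_eq hT]
    field_simp

end ApproximateOrthogonality

section Modulus

open ContinuousLinearMap

theorem norm_sub_algebraMap_midpoint_le {A : Type*} [CStarAlgebra A] [PartialOrder A]
    [StarOrderedRing A] {a : A} {p q : ℝ} (hpq : p ≤ q) (hp : algebraMap ℝ A p ≤ a)
    (hq : a ≤ algebraMap ℝ A q) : ‖a - algebraMap ℝ A ((p + q) / 2)‖ ≤ (q - p) / 2 := by
  set b := a - algebraMap ℝ A ((p + q) / 2) with hb
  have hlow : algebraMap ℝ A (-((q - p) / 2)) ≤ b := by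
    rw [hb, le_sub_iff_add_le, ← map_add]
    convert hp using 2
    ring
  have hup : b ≤ algebraMap ℝ A ((q - p) / 2) := by
    rw [hb, sub_le_iff_le_add, ← map_add]
    convert hq using 2
    ring
  have hbsa : IsSelfAdjoint b := .of_ge hlow (.algebraMap A (.all _))
  rw [algebraMap_le_iff_le_spectrum] at hlow
  rw [le_algebraMap_iff_spectrum_le] at hup
  rw [← cfc_id ℝ b]
  exact norm_cfc_le (by linarith) fun t ht => abs_le.2 ⟨hlow t ht, hup t ht⟩

variable {H : Type*} [NormedAddCommGroup H] [InnerProductSpace ℂ H] [CompleteSpace H]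

theorem adjoint_abs (T : H →L[ℂ] H) : adjoint (CFC.abs T) = CFC.abs T :=
  (CFC.abs_nonneg T).isSelfAdjoint

theorem norm_abs_apply (T : H →L[ℂ] H) (x : H) : ‖CFC.abs T x‖ = ‖T x‖ := by
  have hsq : adjoint (CFC.abs T) ∘L CFC.abs T = adjoint T ∘L T := by
    rw [adjoint_abs]
    exact CFC.abs_mul_abs T
  rw [← sq_eq_sq₀ (norm_nonneg _) (norm_nonneg _), apply_norm_sq_eq_inner_adjoint_left, hsq,
    ← apply_norm_sq_eq_inner_adjoint_left]

theorem algebraMap_minModulus_sq_le_star_mul_self (T : H →L[ℂ] H) :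
    algebraMap ℝ (H →L[ℂ] H) (minModulus T ^ 2) ≤ star T * T := by
  rw [le_def, isPositive_def']
  refine ⟨(IsSelfAdjoint.star_mul_self T).sub (.algebraMap _ (.all _)), fun x => ?_⟩
  have hstar : RCLike.re (inner ℂ ((star T * T) x) x) = ‖T x‖ ^ 2 :=
    (apply_norm_sq_eq_inner_adjoint_left T x).symm
  have hscalar : RCLike.re (inner ℂ (algebraMap ℝ (H →L[ℂ] H) (minModulus T ^ 2) x) x) =
      (minModulus T * ‖x‖) ^ 2 := by
    rw [Algebra.algebraMap_eq_smul_one, smul_apply, one_apply_eq_self,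
      RCLike.real_smul_eq_coe_smul (K := ℂ), inner_smul_left, RCLike.conj_ofReal,
      RCLike.re_ofReal_mul, inner_self_eq_norm_sq, mul_pow]
  rw [reApplyInnerSelf_apply, sub_apply, inner_sub_left, map_sub, hstar, hscalar, sub_nonneg]
  have hm := minModulus_nonneg T
  gcongr
  exact minModulus_mul_norm_le T x

theorem algebraMap_minModulus_le_abs (T : H →L[ℂ] H) :
    algebraMap ℝ (H →L[ℂ] H) (minModulus T) ≤ CFC.abs T := by
  have hnonneg : 0 ≤ algebraMap ℝ (H →L[ℂ] H) (minModulus T) :=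
    algebraMap_nonneg _ (minModulus_nonneg T)
  rw [← CFC.abs_of_nonneg _ hnonneg]
  refine CFC.sqrt_le_sqrt _ _ ?_
  rw [(IsSelfAdjoint.of_nonneg hnonneg).star_eq, ← map_mul, ← sq]
  exact algebraMap_minModulus_sq_le_star_mul_self T

theorem abs_le_algebraMap_norm (T : H →L[ℂ] H) : CFC.abs T ≤ algebraMap ℝ (H →L[ℂ] H) ‖T‖ := by
  rw [← CFC.norm_abs]
  exact IsSelfAdjoint.le_algebraMap_norm_self (.of_nonneg (CFC.abs_nonneg T))

theorem exists_linearIsometry_comp_abs_eq (T : H →L[ℂ] H)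
    (hker : hilbertDim T.ker ≤ hilbertDim (adjoint T).ker) :
    ∃ V : H →ₗᵢ[ℂ] H, ∀ x, V (CFC.abs T x) = T x := by
  have hrange_abs : (CFC.abs T).rangeᗮ = T.ker := by
    ext x
    rw [orthogonal_range, adjoint_abs, LinearMap.mem_ker, LinearMap.mem_ker, coe_coe, coe_coe,
      ← norm_eq_zero, norm_abs_apply, norm_eq_zero]
  rw [← hrange_abs, ← orthogonal_range] at hker
  obtain ⟨W⟩ := nonempty_linearIsometry_of_hilbertDim_le hker
  exact exists_linearIsometry_comp_eq (fun x => (norm_abs_apply T x).symm) W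

theorem infDist_scalarIsometries_eq [Nontrivial H] (T : H →L[ℂ] H)
    (hker : hilbertDim T.ker ≤ hilbertDim (adjoint T).ker) :
    Metric.infDist T (scalarIsometries H) = (‖T‖ - minModulus T) / 2 := by
  obtain ⟨V, hV⟩ := exists_linearIsometry_comp_abs_eq T hker
  set c : ℝ := (minModulus T + ‖T‖) / 2
  have hmem : (c : ℂ) • V.toContinuousLinearMap ∈ scalarIsometries H :=
    ⟨c, V.toContinuousLinearMap, V.isometry, rfl⟩
  have hfactor : T - (c : ℂ) • V.toContinuousLinearMap =
      V.toContinuousLinearMap ∘L (CFC.abs T - algebraMap ℝ _ c) := by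
    ext x
    simp [hV, Algebra.algebraMap_eq_smul_one]
  refine le_antisymm ?_ ?_
  · calc Metric.infDist T (scalarIsometries H)
        ≤ ‖T - (c : ℂ) • V.toContinuousLinearMap‖ :=
          (Metric.infDist_le_dist_of_mem hmem).trans_eq (dist_eq_norm _ _)
      _ = ‖CFC.abs T - algebraMap ℝ _ c‖ := by
          rw [hfactor, V.norm_toContinuousLinearMap_comp]
      _ ≤ (‖T‖ - minModulus T) / 2 :=
          norm_sub_algebraMap_midpoint_le (minModulus_le_norm T) (algebraMap_minModulus_le_abs T)
            (abs_le_algebraMap_norm T)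
  · refine (Metric.le_infDist ⟨_, hmem⟩).2 fun S hS => ?_
    rw [dist_eq_norm]
    exact half_norm_sub_minModulus_le_norm_sub T hS

end Modulus

theorem theorem3p5 {H : Type*} [NormedAddCommGroup H] [InnerProductSpace ℂ H] [CompleteSpace H]
    (hdim : 2 ≤ Module.rank ℂ H) (T : H →L[ℂ] H)
    (hker : hilbertDim (LinearMap.ker (T : H →ₗ[ℂ] H)) ≤
      hilbertDim (LinearMap.ker (ContinuousLinearMap.adjoint T : H →ₗ[ℂ] H))) :
    Metric.infDist T (scalarIsometries H) = (‖T‖ - minModulus T) / 2 ∧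
      (‖T‖ - minModulus T) / 2 =
        (1 - Real.sqrt ((1 - epsHat T) / (1 + epsHat T))) / 2 * ‖T‖ := by
  have : Nontrivial H := rank_pos_iff_nontrivial.1 (zero_lt_two.trans_le hdim)
  exact ⟨infDist_scalarIsometries_eq T hker, half_norm_sub_minModulus_eq T⟩
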